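/- Let $\psi(x)=x$ for $|x|\le 1$ and $\psi(x)=\operatorname{sign}(x)$ for $|x|>1$, let $S^{d-1}$ be the Euclidean unit sphere of $\mathbb{R}^d$, and for a covariance matrix $\Sigma$ with operator norm $\|\Sigma\|$ put $\mathbf{r}(\Sigma)=\operatorname{tr}(\Sigma)/\|\Sigma\|$. There is an absolute constant $c_0\ge 1$ such that the following holds for every $c\ge c_0$. Let $X$ be a square integrable zero mean random vector in $\mathbb{R}^d$ with covariance matrix $\Sigma$ and with $\Pr(X=0)=0$, which satisfies the $L_4$–$L_2$ norm equivalence: for all $v\in\mathbb{R}^d$ and $2\le q\le 4$, \[ (\mathbb{E}|\langle X,v\rangle|^q)^{1/q}\le \kappa(q)\,(\mathbb{E}|\langle X,v\rangle|^2)^{1/2}, \] and write $\kappa=\kappa(4)$. Let $\eta\in[0,\frac{1}{300c\kappa^4}]$, $\delta\in(0,1/4)$ and $N\ge 1$. Let $X_1,\dots,X_N$ be independent copies of $X$, and let $\widetilde X_1,\dots,\widetilde X_N$ be an $\eta$-corrupted sample, that is, it is obtained from $X_1,\dots,X_N$ by replacing at most $\eta N$ points by arbitrary vectors that may depend on $X_1,\dots,X_N$.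 Then, almost surely, there is a unique value $\widehat\alpha>0$ satisfying \[ \frac1N\sup_{v\in S^{d-1}}\sum_{i=1}^N\psi\left(\widehat\alpha^2\langle\widetilde X_i,v\rangle^2\right)=\frac{1}{20c\kappa^4}+\eta . \] If moreover $N\ge 100c\kappa^4\,\mathbf{r}(\Sigma)+400c\kappa^4\log(1/\delta)$, then with probability at least $1-4\delta$, \[ \frac14\|\Sigma\|\le\frac{1}{24c\kappa^4\widehat\alpha^2}\le 4\|\Sigma\| . \] -/

import Mathlib

open MeasureTheory ProbabilityTheory
open scoped RealInnerProductSpace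

namespace RobustCov

/-- The truncation function: the identity on `[-1, 1]` and the sign outside. -/
noncomputable def psi (x : ℝ) : ℝ :=
  if |x| ≤ 1 then x else SignType.sign x

/-- The random vector `X` in `ℝ^d` satisfies the `L_p`-`L_2` norm equivalence with function `κ`:
for all directions `v` and all `q ∈ [2, p]`,
`(E |⟨X, v⟩| ^ q) ^ (1 / q) ≤ κ(q) (E |⟨X, v⟩| ^ 2) ^ (1 / 2)`.
The norms take values in `[0, ∞]`, so that for square integrable `X` the inequality includes the
finiteness of the left-hand side. -/
def NormEquivalence {Ω : Type*} [MeasurableSpace Ω] (μ : Measure Ω) {d : ℕ}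
    (X : Ω → EuclideanSpace ℝ (Fin d)) (p : ℝ) (κ : ℝ → ℝ) : Prop :=
  ∀ v : EuclideanSpace ℝ (Fin d), ∀ q : ℝ, 2 ≤ q → q ≤ p →
    eLpNorm (fun ω => ⟪X ω, v⟫) (ENNReal.ofReal q) μ ≤
      ENNReal.ofReal (κ q) * eLpNorm (fun ω => ⟪X ω, v⟫) 2 μ

/-- The covariance matrix of the random vector `X`. -/
noncomputable def covMatrix {Ω : Type*} [MeasurableSpace Ω] (μ : Measure Ω) {d : ℕ}
    (X : Ω → EuclideanSpace ℝ (Fin d)) : Matrix (Fin d) (Fin d) ℝ :=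
  Matrix.of fun i j => covariance (fun ω => X ω i) (fun ω => X ω j) μ

/-- The Euclidean operator norm of a square matrix. -/
noncomputable def opNorm {d : ℕ} (S : Matrix (Fin d) (Fin d) ℝ) : ℝ :=
  ‖Matrix.toEuclideanCLM (𝕜 := ℝ) S‖

/-- The effective rank `tr(S) / ‖S‖`. -/
noncomputable def effectiveRank {d : ℕ} (S : Matrix (Fin d) (Fin d) ℝ) : ℝ :=
  S.trace / opNorm S

/-- `Y` is an `η`-corrupted version of the sample `X` of size `N`: almost surely, at most `η N`
points are replaced. The replacements are arbitrary functions of the outcome (not even measurable),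
so they may depend on the whole sample and on any further randomness. -/
def IsCorruptedSample {Ω : Type*} [MeasurableSpace Ω] (μ : Measure Ω) {d N : ℕ} (η : ℝ)
    (X Y : Fin N → Ω → EuclideanSpace ℝ (Fin d)) : Prop :=
  ∀ᵐ ω ∂μ, (({i : Fin N | Y i ω ≠ X i ω}.ncard : ℕ) : ℝ) ≤ η * N

/-- `(1 / N) sup_{v ∈ S^{d - 1}} ∑ i, ψ(α² ⟨x_i, v⟩²)`. -/
noncomputable def truncatedSup {d N : ℕ} (x : Fin N → EuclideanSpace ℝ (Fin d)) (α : ℝ) : ℝ :=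
  1 / (N : ℝ) * ⨆ v : Metric.sphere (0 : EuclideanSpace ℝ (Fin d)) 1,
    ∑ i, psi (α ^ 2 * ⟪x i, (v : EuclideanSpace ℝ (Fin d))⟫ ^ 2)

end RobustCov

/-!
The empirical function `F(α) = N⁻¹ sup_v ∑ i, ψ(α² ⟨x_i, v⟩²)` is continuous and vanishes at `0`. As
long as its value is below the proportion of nonzero points it is strictly increasing, and it does
reach that proportion (`exists_unique_truncatedSup_eq`). Replacing `η N` points changes `F` by at
most `η` (`truncatedSup_le_add`). Write `K = c κ⁴` and `M = ‖Σ‖`; the norm equivalence and `Σ ≠ 0`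
force `κ ≥ 1`, so the level `1 / (20 K) + η` is far below `1 - η`, which gives existence and
uniqueness of the solution. For the estimate it suffices to know that, for the clean sample,
`F < 1 / (20 K)` at `α² = 1 / (96 K M)` and `F > 3 / (50 K) ≥ 1 / (20 K) + 2 η` at
`α² = 1 / (6 K M)`: by monotonicity the solution on the corrupted sample lies between these two
scales (`estimate_of_truncatedSup_bounds`). The value `c₀ = 1` works.

The lower bound at the large scale needs one direction only, that of largest variance: there
`exp (-ψ(y)) ≤ 1 - y + y²` and the fourth moment bound give a Chernoff estimate
(`measure_pi_sum_psi_le`).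

The upper bound at the small scale has to be uniform in `v` and is obtained by a PAC-Bayesian
argument (`measure_pi_exists_lt_sum_psi_le`). The direction `v` is smoothed by a centred Gaussian
vector of covariance `β⁻¹`. Since `∏ i, (1 + α² ⟨X_i, θ⟩²)` has expectation at most
`exp (N α² ⟨Σ θ, θ⟩)`, Markov's inequality applied to its average over a centred Gaussian `θ`,
together with the change of measure inequality
`ofReal_exp_integral_add_le_lintegral_stdGaussian`, controls the Gaussian averages of
`∑ i, log (1 + α² ⟨X_i, θ⟩²)` around all `v` at once, at the price `β / 2`. These averages dominate
`log 2 * ∑ i, ψ(α² ⟨X_i, v⟩²)` by a symmetrization over `±g` (`log_two_mul_psi_le`). With `β` equal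
to the effective rank, the bias `tr Σ / β` caused by smoothing is again `‖Σ‖`.
-/

namespace RobustCov

/-! ### Shifting the standard Gaussian measure -/

section Gaussian

variable {E : Type*} [NormedAddCommGroup E] [InnerProductSpace ℝ E] [FiniteDimensional ℝ E]
  [MeasurableSpace E] [BorelSpace E]

variable (E) in
/-- The standard Gaussian measure has a density proportional to `exp (-‖x‖² / 2)`; both sides
have the same characteristic function. -/
lemma stdGaussian_eq_withDensity : ∃ C : ℝ, 0 < C ∧ stdGaussian E =
    volume.withDensity (fun x : E => ENNReal.ofReal (C * Real.exp (-(1 / 2) * ‖x‖ ^ 2))) := by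
  set J : ℝ := ∫ x : E, Real.exp (-(1 / 2) * ‖x‖ ^ 2) with hJ
  have hJval := GaussianFourier.integral_rexp_neg_mul_sq_norm (V := E) (b := 1 / 2) (by norm_num)
  have hJpos : 0 < J := by
    rw [hJ, hJval]; positivity
  have hint : Integrable (fun x : E => Real.exp (-(1 / 2) * ‖x‖ ^ 2)) := by
    by_contra h
    exact hJpos.ne' (integral_undef h)
  refine ⟨J⁻¹, inv_pos.2 hJpos, ?_⟩
  have hfin : IsFiniteMeasure
      (volume.withDensity (fun x : E => ENNReal.ofReal (J⁻¹ * Real.exp (-(1 / 2) * ‖x‖ ^ 2)))) :=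
    isFiniteMeasure_withDensity_ofReal (hint.const_mul _).2
  refine Measure.ext_of_charFun ?_
  ext t
  rw [charFun_stdGaussian, charFun_apply,
    integral_withDensity_eq_integral_toReal_smul (by fun_prop) (by simp)]
  have h := GaussianFourier.integral_cexp_neg_mul_sq_norm_add (V := E) (b := 1 / 2) (by norm_num)
    Complex.I t
  have h0 := GaussianFourier.integral_cexp_neg_mul_sq_norm (V := E) (b := 1 / 2) (by norm_num)
  have hJc : (J : ℂ) = (Real.pi / (1 / 2 : ℂ)) ^ (Module.finrank ℝ E / 2 : ℂ) := by
    rw [← h0, hJ, ← integral_complex_ofReal]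
    simp
  have e : ∀ x : E, (ENNReal.ofReal (J⁻¹ * Real.exp (-(1 / 2) * ‖x‖ ^ 2))).toReal •
      Complex.exp (⟪x, t⟫ * Complex.I) = (J : ℂ)⁻¹ *
        Complex.exp (-(1 / 2 : ℂ) * ‖x‖ ^ 2 + Complex.I * ⟪t, x⟫) := by
    intro x
    rw [ENNReal.toReal_ofReal (by positivity), Complex.real_smul, Complex.exp_add,
      real_inner_comm]
    push_cast
    ring_nf
  simp_rw [e]
  rw [integral_const_mul, h, ← hJc, ← mul_assoc,
    inv_mul_cancel₀ (by exact_mod_cast hJpos.ne'), one_mul]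
  congr 1
  rw [Complex.I_sq]
  ring

/-- Cameron–Martin formula for the standard Gaussian measure. -/
lemma lintegral_stdGaussian_add_left (u : E) {F : E → ENNReal} (hF : Measurable F) :
    ∫⁻ x, F x ∂(stdGaussian E) =
      ∫⁻ x, F (u + x) * ENNReal.ofReal (Real.exp (-⟪u, x⟫ - ‖u‖ ^ 2 / 2)) ∂(stdGaussian E) := by
  obtain ⟨C, hC, h⟩ := stdGaussian_eq_withDensity E
  rw [h, lintegral_withDensity_eq_lintegral_mul _ (by fun_prop) hF,
    lintegral_withDensity_eq_lintegral_mul _ (by fun_prop) (by fun_prop),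
    ← lintegral_add_left_eq_self _ u]
  refine lintegral_congr fun x => ?_
  simp only [Pi.mul_apply]
  rw [mul_comm (F (u + x)), ← mul_assoc, ← ENNReal.ofReal_mul (by positivity), mul_assoc,
    ← Real.exp_add]
  congr 4
  rw [norm_add_sq_real]
  ring

/-- Jensen's inequality for the exponential function, in `[0, ∞]`. -/
lemma ofReal_exp_integral_le_lintegral {Ω : Type*} [MeasurableSpace Ω] {μ : Measure Ω}
    [IsProbabilityMeasure μ] {G : Ω → ℝ} (hG : Integrable G μ) :
    ENNReal.ofReal (Real.exp (∫ ω, G ω ∂μ)) ≤ ∫⁻ ω, ENNReal.ofReal (Real.exp (G ω)) ∂μ := by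
  by_cases h : Integrable (fun ω => Real.exp (G ω)) μ
  · rw [← ofReal_integral_eq_lintegral_ofReal h (ae_of_all _ fun ω => (Real.exp_pos _).le)]
    exact ENNReal.ofReal_le_ofReal (convexOn_exp.map_integral_le
      Real.continuous_exp.continuousOn isClosed_univ (by simp) hG h)
  · have : ∫⁻ ω, ENNReal.ofReal (Real.exp (G ω)) ∂μ = ⊤ := by
      by_contra h'
      refine h ⟨Real.continuous_exp.comp_aestronglyMeasurable hG.1, ?_⟩
      rw [hasFiniteIntegral_iff_ofReal (ae_of_all _ fun ω => (Real.exp_pos _).le)]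
      exact lt_of_le_of_ne le_top h'
    simp [this]

lemma memLp_two_stdGaussian : MemLp id 2 (stdGaussian E) := IsGaussian.memLp_two_id

lemma integrable_inner_stdGaussian (u : E) : Integrable (fun x => ⟪u, x⟫) (stdGaussian E) :=
  (memLp_two_stdGaussian.integrable (by norm_num)).const_inner u

lemma integral_inner_stdGaussian (u : E) : ∫ x, ⟪u, x⟫ ∂(stdGaussian E) = 0 := by
  have := integral_strongDual_stdGaussian (E := E) (innerSL ℝ u)
  simpa using this

lemma integrable_inner_sq_stdGaussian (u : E) :
    Integrable (fun x => ⟪u, x⟫ ^ 2) (stdGaussian E) :=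
  (memLp_two_stdGaussian.const_inner u).integrable_sq

lemma integral_inner_sq_stdGaussian (u : E) : ∫ x, ⟪u, x⟫ ^ 2 ∂(stdGaussian E) = ‖u‖ ^ 2 := by
  have h := variance_dual_stdGaussian (innerSL ℝ u)
  rw [variance_of_integral_eq_zero (by fun_prop) (by simpa using integral_inner_stdGaussian u),
    innerSL_apply_norm] at h
  simpa using h

lemma integral_comp_neg_stdGaussian (F : E → ℝ) :
    ∫ x, F (-x) ∂(stdGaussian E) = ∫ x, F x ∂(stdGaussian E) := by
  have h := stdGaussian_map (E := E) (LinearIsometryEquiv.neg ℝ)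
  conv_rhs => rw [← h]
  exact ((LinearIsometryEquiv.neg ℝ (E := E)).toHomeomorph.measurableEmbedding.integral_map
    (μ := stdGaussian E) F).symm

/-- The change of measure inequality between a standard Gaussian and its shift by `u`, whose
relative entropy is `‖u‖² / 2`. -/
lemma ofReal_exp_integral_add_le_lintegral_stdGaussian (u : E) {H : E → ℝ} (hH : Measurable H)
    (hint : Integrable (fun x => H (u + x)) (stdGaussian E)) :
    ENNReal.ofReal (Real.exp (∫ x, H (u + x) ∂(stdGaussian E) - ‖u‖ ^ 2 / 2)) ≤
      ∫⁻ x, ENNReal.ofReal (Real.exp (H x)) ∂(stdGaussian E) := by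
  rw [lintegral_stdGaussian_add_left u (by fun_prop)]
  have hu := integrable_inner_stdGaussian u
  have hv : Integrable (fun x => -⟪u, x⟫) (stdGaussian E) := hu.neg
  have hw : Integrable (fun x => -⟪u, x⟫ - ‖u‖ ^ 2 / 2) (stdGaussian E) :=
    hv.sub (integrable_const _)
  have h := ofReal_exp_integral_le_lintegral
    (G := fun x => H (u + x) + (-⟪u, x⟫ - ‖u‖ ^ 2 / 2)) (hint.add hw)
  rw [integral_add hint hw, integral_sub hv (integrable_const _), integral_neg,
    integral_inner_stdGaussian] at h
  simp only [neg_zero, integral_const, probReal_univ, smul_eq_mul, one_mul, zero_sub] at h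
  rw [sub_eq_add_neg]
  refine h.trans_eq (lintegral_congr fun x => ?_)
  rw [Real.exp_add, ENNReal.ofReal_mul (Real.exp_pos _).le]

end Gaussian

/-! ### The truncation function -/

lemma psi_of_nonneg {y : ℝ} (hy : 0 ≤ y) : psi y = min y 1 := by
  unfold psi
  rw [abs_of_nonneg hy]
  split_ifs with h
  · rw [min_eq_left h]
  · rw [sign_pos (by linarith), min_eq_right (by linarith)]
    simp

lemma psi_nonneg {y : ℝ} (hy : 0 ≤ y) : 0 ≤ psi y := by
  rw [psi_of_nonneg hy]; positivity

lemma psi_le_one {y : ℝ} (hy : 0 ≤ y) : psi y ≤ 1 := by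
  rw [psi_of_nonneg hy]; exact min_le_right _ _

lemma psi_mono {y z : ℝ} (hy : 0 ≤ y) (h : y ≤ z) : psi y ≤ psi z := by
  rw [psi_of_nonneg hy, psi_of_nonneg (hy.trans h)]
  exact min_le_min_right _ h

lemma log_two_mul_le_log_one_add {y : ℝ} (h0 : 0 ≤ y) (h1 : y ≤ 1) :
    Real.log 2 * y ≤ Real.log (1 + y) := by
  rw [Real.le_log_iff_exp_le (by linarith), ← Real.rpow_def_of_pos (by norm_num)]
  have h := rpow_one_add_le_one_add_mul_self (s := 1) (by norm_num) h0 h1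
  norm_num at h
  exact h

/-- The function `t ↦ log (1 + t²)` is convex only near the origin, but its average over
`a ± b` still dominates the truncation at `a`, up to the constant `log 2`. -/
lemma log_two_mul_psi_le (a b : ℝ) :
    2 * (Real.log 2 * psi (a ^ 2)) ≤
      Real.log (1 + (a + b) ^ 2) + Real.log (1 + (a - b) ^ 2) := by
  rw [← Real.log_mul (by positivity) (by positivity), psi_of_nonneg (sq_nonneg a)]
  rcases le_total (a ^ 2) 1 with h | h
  · rw [min_eq_left h]
    have h1 := log_two_mul_le_log_one_add (sq_nonneg a) h
    have h2 : Real.log ((1 + a ^ 2) ^ 2) ≤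
        Real.log ((1 + (a + b) ^ 2) * (1 + (a - b) ^ 2)) := by
      apply Real.log_le_log (by positivity)
      nlinarith [mul_nonneg (sq_nonneg b) (sub_nonneg.2 h), sq_nonneg (b ^ 2)]
    rw [Real.log_pow] at h2
    push_cast at h2
    linarith
  · rw [min_eq_right h]
    have h2 : Real.log ((2 : ℝ) ^ 2) ≤
        Real.log ((1 + (a + b) ^ 2) * (1 + (a - b) ^ 2)) := by
      apply Real.log_le_log (by positivity)
      nlinarith [sq_nonneg (b ^ 2 - (a ^ 2 - 1))]
    rw [Real.log_pow] at h2
    push_cast at h2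
    linarith

lemma exp_neg_psi_le {y : ℝ} (hy : 0 ≤ y) : Real.exp (-psi y) ≤ 1 - y + y ^ 2 := by
  rw [psi_of_nonneg hy]
  rcases le_total y 1 with h | h
  · rw [min_eq_left h]
    have h1 : 1 + y ≤ Real.exp y := by linarith [Real.add_one_le_exp y]
    rw [Real.exp_neg, inv_le_iff_one_le_mul₀ (Real.exp_pos _)]
    have : 1 ≤ (1 - y + y ^ 2) * (1 + y) := by nlinarith [pow_nonneg hy 3]
    exact this.trans (mul_le_mul_of_nonneg_left h1 (by nlinarith))
  · have : Real.exp (-min y 1) ≤ 1 := by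
      rw [Real.exp_le_one_iff, min_eq_right h]; norm_num
    nlinarith

@[fun_prop]
lemma continuous_psi_sq {X : Type*} [TopologicalSpace X] {f : X → ℝ} (hf : Continuous f) :
    Continuous fun x => psi (f x ^ 2) := by
  simp_rw [psi_of_nonneg (sq_nonneg _)]
  fun_prop

/-! ### Uniform upper tail by a PAC-Bayesian argument -/

lemma integrable_inner_sq {E : Type*} [NormedAddCommGroup E] [InnerProductSpace ℝ E]
    [MeasurableSpace E] {ν : Measure E} (hν : MemLp id 2 ν) (u : E) :
    Integrable (fun x => ⟪x, u⟫ ^ 2) ν :=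
  (hν.inner_const u).integrable_sq

lemma integrable_norm_sq {E : Type*} [NormedAddCommGroup E] [MeasurableSpace E] {ν : Measure E}
    (hν : MemLp id 2 ν) : Integrable (fun x => ‖x‖ ^ 2) ν :=
  hν.integrable_norm_pow (by norm_num)

lemma lintegral_pi_prod {E : Type*} [MeasurableSpace E] {ν : Measure E} [IsProbabilityMeasure ν]
    {N : ℕ} {f : E → ENNReal} (hf : Measurable f) :
    ∫⁻ x, ∏ i : Fin N, f (x i) ∂(Measure.pi fun _ => ν) = (∫⁻ x, f x ∂ν) ^ N := by
  have hind : iIndepFun (fun (i : Fin N) (x : Fin N → E) => f (x i)) (Measure.pi fun _ => ν) :=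
    iIndepFun_pi (X := fun _ => f) fun _ => hf.aemeasurable
  rw [lintegral_prod_eq_prod_lintegral_of_indepFun Finset.univ _ hind (fun i => by fun_prop)]
  have : ∀ i : Fin N, ∫⁻ x : Fin N → E, f (x i) ∂(Measure.pi fun _ => ν) = ∫⁻ x, f x ∂ν :=
    fun i => (measurePreserving_eval (fun _ => ν) i).lintegral_comp hf
  simp [this]

section PacBayes

variable {E : Type*} [NormedAddCommGroup E] [InnerProductSpace ℝ E] [FiniteDimensional ℝ E]
  [MeasurableSpace E] [BorelSpace E]

lemma integrable_log_one_add_inner_sq (u x : E) :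
    Integrable (fun g => Real.log (1 + ⟪x, u + g⟫ ^ 2)) (stdGaussian E) := by
  have h : Integrable (fun g => ⟪x, u + g⟫ ^ 2) (stdGaussian E) := by
    simp_rw [inner_add_right]
    exact ((memLp_const ⟪x, u⟫).add (memLp_two_stdGaussian.const_inner x)).integrable_sq
  refine h.mono' (Measurable.aestronglyMeasurable (by fun_prop)) (ae_of_all _ fun g => ?_)
  rw [Real.norm_of_nonneg (Real.log_nonneg (by nlinarith [sq_nonneg ⟪x, u + g⟫]))]
  linarith [Real.log_le_sub_one_of_pos (show 0 < 1 + ⟪x, u + g⟫ ^ 2 by positivity)]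

/-- Smoothing by a symmetric perturbation keeps `log (1 + t²)` above the truncation. -/
lemma log_two_mul_psi_le_integral (u x : E) :
    Real.log 2 * psi (⟪x, u⟫ ^ 2) ≤
      ∫ g, Real.log (1 + ⟪x, u + g⟫ ^ 2) ∂(stdGaussian E) := by
  have h1 := integrable_log_one_add_inner_sq u x
  have h2 : Integrable (fun g => Real.log (1 + ⟪x, u - g⟫ ^ 2)) (stdGaussian E) := by
    refine (integrable_log_one_add_inner_sq (-u) x).congr (ae_of_all _ fun g => ?_)
    simp only
    rw [show u - g = -(-u + g) by abel, inner_neg_right, neg_sq]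
  have h3 : ∫ g, Real.log (1 + ⟪x, u - g⟫ ^ 2) ∂(stdGaussian E) =
      ∫ g, Real.log (1 + ⟪x, u + g⟫ ^ 2) ∂(stdGaussian E) := by
    rw [← integral_comp_neg_stdGaussian]
    simp [sub_eq_add_neg]
  have h4 : ∫ _g, 2 * (Real.log 2 * psi (⟪x, u⟫ ^ 2)) ∂(stdGaussian E) ≤
      ∫ g, (Real.log (1 + ⟪x, u + g⟫ ^ 2) + Real.log (1 + ⟪x, u - g⟫ ^ 2))
        ∂(stdGaussian E) := by
    refine integral_mono (integrable_const _) (h1.add h2) fun g => ?_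
    simp only [inner_add_right, inner_sub_right]
    exact log_two_mul_psi_le _ _
  rw [integral_add h1 h2, h3] at h4
  simp only [integral_const, probReal_univ, smul_eq_mul, one_mul] at h4
  linarith


lemma integrable_prod_inner_add_sq {ν : Measure E} (hν : MemLp id 2 ν) (u : E) :
    Integrable (fun p : E × E => ⟪p.2, u + p.1⟫ ^ 2) ((stdGaussian E).prod ν) := by
  have h : Integrable (fun g : E => ‖u + g‖ ^ 2) (stdGaussian E) :=
    ((memLp_const u).add memLp_two_stdGaussian).integrable_norm_pow (by norm_num)
  refine (h.mul_prod (integrable_norm_sq hν)).mono' (by fun_prop) (ae_of_all _ fun p => ?_)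
  rw [Real.norm_of_nonneg (sq_nonneg _), mul_comm, ← mul_pow, ← sq_abs]
  gcongr
  exact abs_real_inner_le_norm _ _

variable {ν : Measure E} [IsProbabilityMeasure ν]

lemma integral_integral_inner_add_sq (hν : MemLp id 2 ν) (u : E) :
    ∫ g, ∫ x, ⟪x, u + g⟫ ^ 2 ∂ν ∂(stdGaussian E) = ∫ x, ⟪x, u⟫ ^ 2 ∂ν + ∫ x, ‖x‖ ^ 2 ∂ν := by
  rw [integral_integral_swap (integrable_prod_inner_add_sq hν u),
    ← integral_add (integrable_inner_sq hν u) (integrable_norm_sq hν)]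
  refine integral_congr_ae (ae_of_all _ fun x => ?_)
  simp only [inner_add_right, add_sq]
  have h1 := integrable_inner_stdGaussian x
  have h2 := integrable_inner_sq_stdGaussian x
  have h3 : Integrable (fun g => 2 * ⟪x, u⟫ * ⟪x, g⟫) (stdGaussian E) := h1.const_mul _
  have h4 : Integrable (fun g => ⟪x, u⟫ ^ 2 + 2 * ⟪x, u⟫ * ⟪x, g⟫) (stdGaussian E) :=
    (integrable_const _).add h3
  rw [integral_add h4 h2, integral_add (integrable_const _) h3, integral_const_mul,
    integral_inner_stdGaussian, integral_inner_sq_stdGaussian]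
  simp

/-- PAC-Bayesian upper bound, uniform over the sphere: outside of an event of probability `δ`,
all truncated empirical quadratic forms are controlled by the largest second moment `S` of a
one-dimensional marginal and by the trace `∫ ‖x‖²`, smoothed at scale `β`. -/
theorem measure_pi_exists_lt_sum_psi_le (hν : MemLp id 2 ν) {S : ℝ}
    (hS : ∀ v : E, ‖v‖ = 1 → ∫ x, ⟪x, v⟫ ^ 2 ∂ν ≤ S) (α : ℝ) {β δ : ℝ} (hβ : 0 < β) (hδ : 0 < δ)
    (N : ℕ) :
    Measure.pi (fun _ : Fin N => ν) {x | ∃ v : E, ‖v‖ = 1 ∧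
      N * (α ^ 2 * (S + (∫ x, ‖x‖ ^ 2 ∂ν) / β)) + β / 2 + Real.log (1 / δ) <
        Real.log 2 * ∑ i, psi (α ^ 2 * ⟪x i, v⟫ ^ 2)} ≤ ENNReal.ofReal δ := by
  set q : E → ℝ := fun θ => ∫ x, ⟪x, θ⟫ ^ 2 ∂ν with hq
  have hqm : Measurable q := by
    have : StronglyMeasurable (Function.uncurry fun (θ x : E) => ⟪x, θ⟫ ^ 2) :=
      Continuous.stronglyMeasurable (by fun_prop)
    exact this.integral_prod_right.measurable
  -- A shift by `√β • v` of the standard Gaussian amounts to a Gaussian of covariance `β⁻¹`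
  -- around `v` once the scale `α` is divided by `√β`.
  set a : ℝ := α / √β with ha
  have ha2 : a ^ 2 = α ^ 2 / β := by rw [ha, div_pow, Real.sq_sqrt hβ.le]
  set H : (Fin N → E) → E → ℝ := fun x θ =>
    ∑ i, Real.log (1 + ⟪a • x i, θ⟫ ^ 2) - N * (a ^ 2 * q θ) with hH
  have hHm : Measurable (Function.uncurry H) := by
    simp only [hH, Function.uncurry_def]
    fun_prop
  set W : (Fin N → E) → ENNReal := fun x =>
    ∫⁻ θ, ENNReal.ofReal (Real.exp (H x θ)) ∂(stdGaussian E) with hW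
  have hWm : Measurable W :=
    Measurable.lintegral_prod_right' (f := fun p : (Fin N → E) × E =>
      ENNReal.ofReal (Real.exp (H p.1 p.2))) (by fun_prop)
  have hW1 : ∫⁻ x, W x ∂(Measure.pi fun _ => ν) ≤ 1 := by
    rw [hW, lintegral_lintegral_swap (by fun_prop)]
    have hθ : ∀ θ, ∫⁻ x, ENNReal.ofReal (Real.exp (H x θ)) ∂(Measure.pi fun _ => ν) ≤ 1 := by
      intro θ
      have e : ∀ x : Fin N → E, ENNReal.ofReal (Real.exp (H x θ)) =
          ENNReal.ofReal (Real.exp (-(N * (a ^ 2 * q θ)))) *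
            ∏ i, ENNReal.ofReal (1 + ⟪a • x i, θ⟫ ^ 2) := by
        intro x
        rw [← ENNReal.ofReal_prod_of_nonneg (fun i _ => by positivity),
          ← ENNReal.ofReal_mul (Real.exp_pos _).le]
        congr 1
        rw [hH]
        simp only
        rw [sub_eq_neg_add, Real.exp_add, Real.exp_sum]
        congr 1
        exact Finset.prod_congr rfl fun i _ => Real.exp_log (by positivity)
      simp_rw [e]
      rw [lintegral_const_mul _ (by fun_prop),
        lintegral_pi_prod (f := fun y => ENNReal.ofReal (1 + ⟪a • y, θ⟫ ^ 2)) (by fun_prop)]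
      have e2 : ∫⁻ y, ENNReal.ofReal (1 + ⟪a • y, θ⟫ ^ 2) ∂ν = ENNReal.ofReal (1 + a ^ 2 * q θ) := by
        simp_rw [real_inner_smul_left, mul_pow]
        have hi : Integrable (fun y => a ^ 2 * ⟪y, θ⟫ ^ 2) ν :=
          (integrable_inner_sq hν θ).const_mul _
        have hi1 : Integrable (fun y => 1 + a ^ 2 * ⟪y, θ⟫ ^ 2) ν := (integrable_const _).add hi
        rw [← ofReal_integral_eq_lintegral_ofReal hi1
          (ae_of_all _ fun y => by positivity), integral_add (integrable_const _) hi,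
          integral_const_mul]
        simp [hq]
      have hle : 1 + a ^ 2 * q θ ≤ Real.exp (a ^ 2 * q θ) := by
        linarith [Real.add_one_le_exp (a ^ 2 * q θ)]
      calc _ ≤ ENNReal.ofReal (Real.exp (-(N * (a ^ 2 * q θ)))) *
            (ENNReal.ofReal (Real.exp (a ^ 2 * q θ))) ^ N := by
            rw [e2]; gcongr
        _ = 1 := by
            rw [← ENNReal.ofReal_pow (Real.exp_pos _).le, ← ENNReal.ofReal_mul (Real.exp_pos _).le,
              ← Real.exp_nat_mul, ← Real.exp_add]
            simp
    calc _ ≤ ∫⁻ _θ, 1 ∂(stdGaussian E) := lintegral_mono hθ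
      _ = 1 := by simp
  have hsub : {x : Fin N → E | ∃ v : E, ‖v‖ = 1 ∧
      N * (α ^ 2 * (S + (∫ x, ‖x‖ ^ 2 ∂ν) / β)) + β / 2 + Real.log (1 / δ) <
        Real.log 2 * ∑ i, psi (α ^ 2 * ⟪x i, v⟫ ^ 2)} ⊆
      {x | ENNReal.ofReal (1 / δ) ≤ W x} := by
    rintro x ⟨v, hv, hlt⟩
    set u : E := √β • v with hu
    have hun : ‖u‖ ^ 2 = β := by
      rw [hu, norm_smul, hv, mul_one, Real.norm_of_nonneg (Real.sqrt_nonneg _), Real.sq_sqrt hβ.le]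
    have hi : ∀ i, Integrable (fun g => Real.log (1 + ⟪a • x i, u + g⟫ ^ 2)) (stdGaussian E) :=
      fun i => integrable_log_one_add_inner_sq u (a • x i)
    have hqi : Integrable (fun g => q (u + g)) (stdGaussian E) :=
      (integrable_prod_inner_add_sq hν u).integral_prod_left
    have hqi' : Integrable (fun g => N * (a ^ 2 * q (u + g))) (stdGaussian E) :=
      (hqi.const_mul _).const_mul _
    have hsi : Integrable (fun g => ∑ i, Real.log (1 + ⟪a • x i, u + g⟫ ^ 2)) (stdGaussian E) :=
      integrable_finsetSum Finset.univ fun i _ => hi i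
    have hHx : Integrable (fun g => H x (u + g)) (stdGaussian E) := by
      simp only [hH]
      exact hsi.sub hqi'
    have hHxm : Measurable (H x) := hHm.of_uncurry_left
    have hDV := ofReal_exp_integral_add_le_lintegral_stdGaussian u hHxm hHx
    refine le_trans (ENNReal.ofReal_le_ofReal ?_) hDV
    rw [← Real.exp_log (show 0 < 1 / δ by positivity)]
    refine Real.exp_le_exp.2 ?_
    simp only [hH]
    rw [integral_sub hsi hqi', integral_finsetSum _ fun i _ => hi i, integral_const_mul,
      integral_const_mul, hun]
    simp only [hq]
    rw [integral_integral_inner_add_sq hν u]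
    have h1 : Real.log 2 * ∑ i, psi (α ^ 2 * ⟪x i, v⟫ ^ 2) ≤
        ∑ i, ∫ g, Real.log (1 + ⟪a • x i, u + g⟫ ^ 2) ∂(stdGaussian E) := by
      rw [Finset.mul_sum]
      refine Finset.sum_le_sum fun i _ => ?_
      refine le_trans (le_of_eq ?_) (log_two_mul_psi_le_integral u (a • x i))
      congr 2
      rw [hu, real_inner_smul_left, real_inner_smul_right, mul_pow, mul_pow, ha2,
        Real.sq_sqrt hβ.le]
      field_simp
    have h2 : ∫ x, ⟪x, u⟫ ^ 2 ∂ν = β * ∫ x, ⟪x, v⟫ ^ 2 ∂ν := by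
      simp_rw [hu, real_inner_smul_right, mul_pow, Real.sq_sqrt hβ.le]
      rw [integral_const_mul]
    have h3 : (N : ℝ) * (a ^ 2 * (∫ x, ⟪x, u⟫ ^ 2 ∂ν + ∫ x, ‖x‖ ^ 2 ∂ν)) ≤
        N * (α ^ 2 * (S + (∫ x, ‖x‖ ^ 2 ∂ν) / β)) := by
      have : a ^ 2 * (∫ x, ⟪x, u⟫ ^ 2 ∂ν + ∫ x, ‖x‖ ^ 2 ∂ν) =
          α ^ 2 * (∫ x, ⟪x, v⟫ ^ 2 ∂ν + (∫ x, ‖x‖ ^ 2 ∂ν) / β) := by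
        rw [ha2, h2]; field_simp
      rw [this]
      gcongr
      exact hS v hv
    linarith
  refine (measure_mono hsub).trans ?_
  have hM := (mul_meas_ge_le_lintegral₀ (μ := Measure.pi fun _ : Fin N => ν) hWm.aemeasurable
    (ENNReal.ofReal (1 / δ))).trans hW1
  rw [one_div, ENNReal.ofReal_inv_of_pos hδ] at hM ⊢
  rw [mul_comm, ← div_eq_mul_inv] at hM
  rwa [ENNReal.div_le_iff (by simpa using hδ) (by simp), one_mul] at hM

end PacBayes

/-! ### Lower tail in a fixed direction -/

/-- Chernoff bound for the lower tail of a truncated empirical mean of a nonnegative function. -/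
theorem measure_pi_sum_psi_le {E : Type*} [MeasurableSpace E] {ν : Measure E}
    [IsProbabilityMeasure ν] {f : E → ℝ} (hfm : Measurable f) (hf0 : ∀ x, 0 ≤ f x)
    (hf1 : Integrable f ν) (hf2 : Integrable (fun x => f x ^ 2) ν) (N : ℕ) (s : ℝ) :
    Measure.pi (fun _ : Fin N => ν) {x | ∑ i, psi (f (x i)) ≤ s} ≤
      ENNReal.ofReal (Real.exp (s - N * (∫ x, f x ∂ν - ∫ x, f x ^ 2 ∂ν))) := by
  set m : ℝ := ∫ x, f x ∂ν - ∫ x, f x ^ 2 ∂ν with hm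
  have hpm : Measurable fun x => psi (f x) := by
    simp_rw [fun x => psi_of_nonneg (hf0 x)]
    fun_prop
  set W : (Fin N → E) → ENNReal := fun x => ∏ i, ENNReal.ofReal (Real.exp (-psi (f (x i))))
  have hWm : Measurable W := Finset.measurable_fun_prod _ fun i _ =>
    ((hpm.comp (measurable_pi_apply i)).neg.exp).ennreal_ofReal
  have h1 : ∫⁻ x, ENNReal.ofReal (Real.exp (-psi (f x))) ∂ν ≤ ENNReal.ofReal (Real.exp (-m)) := by
    have hi0 : Integrable (fun x => 1 - f x) ν := (integrable_const 1).sub hf1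
    have hi : Integrable (fun x => 1 - f x + f x ^ 2) ν := hi0.add hf2
    calc ∫⁻ x, ENNReal.ofReal (Real.exp (-psi (f x))) ∂ν
        ≤ ∫⁻ x, ENNReal.ofReal (1 - f x + f x ^ 2) ∂ν :=
          lintegral_mono fun x => ENNReal.ofReal_le_ofReal (exp_neg_psi_le (hf0 x))
      _ = ENNReal.ofReal (1 - m) := by
          rw [← ofReal_integral_eq_lintegral_ofReal hi
            (ae_of_all _ fun x => (Real.exp_pos _).le.trans (exp_neg_psi_le (hf0 x))),
            integral_add hi0 hf2, integral_sub (integrable_const 1) hf1]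
          congr 1
          simp [hm]
          ring
      _ ≤ _ := ENNReal.ofReal_le_ofReal (by linarith [Real.add_one_le_exp (-m)])
  have hW : ∫⁻ x, W x ∂(Measure.pi fun _ => ν) ≤ ENNReal.ofReal (Real.exp (-(N * m))) := by
    rw [lintegral_pi_prod (f := fun y => ENNReal.ofReal (Real.exp (-psi (f y)))) (by fun_prop)]
    calc _ ≤ ENNReal.ofReal (Real.exp (-m)) ^ N := by gcongr
      _ = _ := by
        rw [← ENNReal.ofReal_pow (Real.exp_pos _).le, ← Real.exp_nat_mul]
        congr 2; ring
  have hsub : {x : Fin N → E | ∑ i, psi (f (x i)) ≤ s} ⊆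
      {x | ENNReal.ofReal (Real.exp (-s)) ≤ W x} := by
    intro x hx
    simp only [Set.mem_ofPred_eq, W] at hx ⊢
    rw [← ENNReal.ofReal_prod_of_nonneg (fun i _ => (Real.exp_pos _).le), ← Real.exp_sum,
      Finset.sum_neg_distrib]
    exact ENNReal.ofReal_le_ofReal (Real.exp_le_exp.2 (neg_le_neg hx))
  refine (measure_mono hsub).trans ?_
  have hM := (mul_meas_ge_le_lintegral₀ (μ := Measure.pi fun _ : Fin N => ν) 
    hWm.aemeasurable (ENNReal.ofReal (Real.exp (-s)))).trans hW
  rw [mul_comm, ← ENNReal.le_div_iff_mul_le (by simp [Real.exp_pos]) (by simp),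
    ← ENNReal.ofReal_div_of_pos (Real.exp_pos _), ← Real.exp_sub] at hM
  refine hM.trans (le_of_eq ?_)
  congr 2; ring

/-! ### The truncated supremum of a fixed sample -/

section Deterministic

variable {d N : ℕ} (x : Fin N → EuclideanSpace ℝ (Fin d))

lemma sum_psi_le_card (α : ℝ) (v : EuclideanSpace ℝ (Fin d)) :
    ∑ i, psi (α ^ 2 * ⟪x i, v⟫ ^ 2) ≤ N := by
  calc _ ≤ ∑ _i : Fin N, (1 : ℝ) := Finset.sum_le_sum fun i _ => psi_le_one (by positivity)
    _ = N := by simp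

lemma bddAbove_range_sum_psi (α : ℝ) :
    BddAbove (Set.range fun v : Metric.sphere (0 : EuclideanSpace ℝ (Fin d)) 1 =>
      ∑ i, psi (α ^ 2 * ⟪x i, (v : EuclideanSpace ℝ (Fin d))⟫ ^ 2)) :=
  ⟨N, by rintro _ ⟨v, rfl⟩; exact sum_psi_le_card x α v⟩

variable {x}

lemma sum_psi_le_truncatedSup (hN : 1 ≤ N) (α : ℝ) {v : EuclideanSpace ℝ (Fin d)} (hv : ‖v‖ = 1) :
    ∑ i, psi (α ^ 2 * ⟪x i, v⟫ ^ 2) ≤ N * truncatedSup x α := by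
  have hN' : (0 : ℝ) < N := by exact_mod_cast hN
  rw [truncatedSup, ← mul_assoc, mul_one_div_cancel hN'.ne', one_mul]
  exact le_ciSup (bddAbove_range_sum_psi x α) ⟨v, by simpa using hv⟩

lemma continuous_truncatedSup (x : Fin N → EuclideanSpace ℝ (Fin d)) :
    Continuous (truncatedSup x) := by
  have h := (isCompact_sphere (0 : EuclideanSpace ℝ (Fin d)) 1).continuous_sSup
    (f := fun (α : ℝ) v => ∑ i, psi (α ^ 2 * ⟪x i, v⟫ ^ 2)) (by
      simp_rw [← mul_pow]
      fun_prop)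
  have e : truncatedSup x = fun α => 1 / (N : ℝ) *
      sSup ((fun v => ∑ i, psi (α ^ 2 * ⟪x i, v⟫ ^ 2)) ''
        Metric.sphere (0 : EuclideanSpace ℝ (Fin d)) 1) := by
    ext α
    rw [truncatedSup, sSup_image']
  rw [e]
  exact continuous_const.mul h

lemma exists_forall_inner_ne_zero (x : Fin N → EuclideanSpace ℝ (Fin d)) :
    ∃ v : EuclideanSpace ℝ (Fin d), ∀ i, x i ≠ 0 → ⟪x i, v⟫ ≠ 0 := by
  by_contra! hcon
  obtain ⟨i, hi⟩ := Subspace.exists_eq_top_of_iUnion_eq_univ (k := ℝ)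
    (p := fun i : {i // x i ≠ 0} => (Submodule.span ℝ {x i})ᗮ) (by
      refine Set.eq_univ_of_forall fun v => ?_
      obtain ⟨i, hi, h⟩ := hcon v
      exact Set.mem_iUnion.2 ⟨⟨i, hi⟩, Submodule.mem_orthogonal_singleton_iff_inner_right.2 h⟩)
  have : x i ∈ (Submodule.span ℝ {x i})ᗮ := by rw [hi]; trivial
  exact i.2 (inner_self_eq_zero.1 (Submodule.mem_orthogonal_singleton_iff_inner_right.1 this))

lemma sum_psi_inner_normalize_le (hN : 1 ≤ N) (α : ℝ) {w : EuclideanSpace ℝ (Fin d)}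
    (hw : w ≠ 0) :
    ∑ i, psi (α ^ 2 * ⟪x i, w⟫ ^ 2 / ‖w‖ ^ 2) ≤ N * truncatedSup x α := by
  refine le_trans (le_of_eq ?_) (sum_psi_le_truncatedSup (v := ‖w‖⁻¹ • w) hN α ?_)
  · refine Finset.sum_congr rfl fun i _ => ?_
    rw [real_inner_smul_right, mul_pow, inv_pow]
    congr 1
    field_simp
  · rw [norm_smul, norm_inv, norm_norm, inv_mul_cancel₀ (norm_ne_zero_iff.2 hw)]

variable [Nontrivial (EuclideanSpace ℝ (Fin d))]

lemma truncatedSup_le (hN : 1 ≤ N) {α b : ℝ}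
    (h : ∀ v : EuclideanSpace ℝ (Fin d), ‖v‖ = 1 → ∑ i, psi (α ^ 2 * ⟪x i, v⟫ ^ 2) ≤ N * b) :
    truncatedSup x α ≤ b := by
  have hN' : (0 : ℝ) < N := by exact_mod_cast hN
  have : Nonempty (Metric.sphere (0 : EuclideanSpace ℝ (Fin d)) 1) :=
    (NormedSpace.sphere_nonempty.2 zero_le_one).to_subtype
  rw [truncatedSup, one_div, inv_mul_le_iff₀ hN']
  exact ciSup_le fun v => h v (by simp)

lemma exists_sum_psi_eq_truncatedSup (hN : 1 ≤ N) (x : Fin N → EuclideanSpace ℝ (Fin d)) (α : ℝ) :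
    ∃ v : EuclideanSpace ℝ (Fin d), ‖v‖ = 1 ∧
      ∑ i, psi (α ^ 2 * ⟪x i, v⟫ ^ 2) = N * truncatedSup x α := by
  have hN' : (0 : ℝ) < N := by exact_mod_cast hN
  obtain ⟨v, hv, hmax⟩ := (isCompact_sphere (0 : EuclideanSpace ℝ (Fin d)) 1).exists_isMaxOn
    (NormedSpace.sphere_nonempty.2 zero_le_one)
    (f := fun v => ∑ i, psi (α ^ 2 * ⟪x i, v⟫ ^ 2)) (Continuous.continuousOn (by
      simp_rw [← mul_pow]
      fun_prop))
  have hv1 : ‖v‖ = 1 := by simpa using hv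
  refine ⟨v, hv1, le_antisymm (sum_psi_le_truncatedSup hN α hv1) ?_⟩
  rw [← le_div_iff₀' hN']
  refine truncatedSup_le hN fun w hw => ?_
  rw [mul_div_cancel₀ _ hN'.ne']
  exact hmax (by simpa using hw)

lemma truncatedSup_zero (hN : 1 ≤ N) : truncatedSup x 0 = 0 := by
  obtain ⟨v, -, h⟩ := exists_sum_psi_eq_truncatedSup hN x 0
  have hN' : (0 : ℝ) < N := by exact_mod_cast hN
  simp [psi_of_nonneg, hN'.ne'] at h
  exact h

lemma truncatedSup_mono (hN : 1 ≤ N) {α α' : ℝ} (h0 : 0 ≤ α) (h : α ≤ α') :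
    truncatedSup x α ≤ truncatedSup x α' := by
  refine truncatedSup_le hN fun v hv => le_trans ?_ (sum_psi_le_truncatedSup hN α' hv)
  gcongr with i
  exact psi_mono (by positivity) (by gcongr)

/-- Replacing at most `η N` points moves the truncated supremum by at most `η`. -/
lemma truncatedSup_le_add (hN : 1 ≤ N) {y : Fin N → EuclideanSpace ℝ (Fin d)} {η : ℝ}
    (h : (({i | y i ≠ x i}.ncard : ℕ) : ℝ) ≤ η * N) (α : ℝ) :
    truncatedSup y α ≤ truncatedSup x α + η := by
  classical
  refine truncatedSup_le hN fun v hv => ?_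
  have hx := sum_psi_le_truncatedSup (x := x) hN α hv
  have h1 : ∑ i, psi (α ^ 2 * ⟪y i, v⟫ ^ 2) ≤
      ∑ i, (psi (α ^ 2 * ⟪x i, v⟫ ^ 2) + if y i ≠ x i then 1 else 0) := by
    refine Finset.sum_le_sum fun i _ => ?_
    split_ifs with hi
    · have := psi_le_one (y := α ^ 2 * ⟪y i, v⟫ ^ 2) (by positivity)
      have := psi_nonneg (y := α ^ 2 * ⟪x i, v⟫ ^ 2) (by positivity)
      linarith
    · rw [not_not.1 hi]; simp
  rw [Finset.sum_add_distrib, Finset.sum_boole] at h1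
  rw [Set.ncard_eq_toFinset_card'] at h
  simp only [Set.toFinset_ofPred] at h
  linarith

/-- Below the proportion of nonzero points, the truncated supremum is strictly increasing. The
delicate case is that of a maximizing direction for which every point is either orthogonal or
already truncated: the direction is then tilted towards a nonzero orthogonal point. -/
lemma truncatedSup_lt_of_lt (hN : 1 ≤ N) {α α' : ℝ} (h0 : 0 < α) (h : α < α')
    (hlt : N * truncatedSup x α < ((Finset.univ.filter fun i => x i ≠ 0).card : ℝ)) :
    truncatedSup x α < truncatedSup x α' := by
  classical
  have hN' : (0 : ℝ) < N := by exact_mod_cast hN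
  obtain ⟨v, hv, hsum⟩ := exists_sum_psi_eq_truncatedSup hN x α
  rw [← mul_lt_mul_iff_right₀ hN', ← hsum]
  have h0' : 0 < α' := h0.trans h
  have hsq : α ^ 2 < α' ^ 2 := by gcongr
  by_cases hA : ∃ i, ⟪x i, v⟫ ≠ 0 ∧ α ^ 2 * ⟪x i, v⟫ ^ 2 < 1
  · obtain ⟨i, hi, hi1⟩ := hA
    refine lt_of_lt_of_le ?_ (sum_psi_le_truncatedSup hN α' hv)
    refine Finset.sum_lt_sum (fun j _ => psi_mono (by positivity) (by gcongr))
      ⟨i, Finset.mem_univ _, ?_⟩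
    have hpos : 0 < ⟪x i, v⟫ ^ 2 := by positivity
    rw [psi_of_nonneg (by positivity), psi_of_nonneg (by positivity), min_eq_left hi1.le]
    exact lt_min (by gcongr) hi1
  · push Not at hA
    set s : Finset (Fin N) := Finset.univ.filter fun i => ⟪x i, v⟫ ≠ 0 with hs
    have hcard : ∑ i, psi (α ^ 2 * ⟪x i, v⟫ ^ 2) = (s.card : ℝ) := by
      rw [hs, ← Finset.sum_boole]
      refine Finset.sum_congr rfl fun i _ => ?_
      rw [psi_of_nonneg (by positivity)]
      split_ifs with hi
      · exact min_eq_right (hA i hi)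
      · rw [not_not.1 hi]; simp
    obtain ⟨j, hj, hjs⟩ : ∃ j, x j ≠ 0 ∧ ⟪x j, v⟫ = 0 := by
      by_contra! hcon
      rw [← hsum, hcard, Nat.cast_lt] at hlt
      refine absurd (Finset.card_le_card fun i hi => ?_) (not_le.2 hlt)
      simp only [hs, Finset.mem_filter, Finset.mem_univ, true_and] at hi ⊢
      exact hcon i hi
    have hev : ∀ i ∈ s, ∀ᶠ t in nhdsWithin (0 : ℝ) (Set.Ioi 0),
        ‖v + t • x j‖ ^ 2 < α' ^ 2 * ⟪x i, v + t • x j⟫ ^ 2 := by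
      intro i hi
      have hi' : ⟪x i, v⟫ ≠ 0 := by simpa [hs] using hi
      refine Filter.Eventually.filter_mono nhdsWithin_le_nhds ?_
      refine (ContinuousAt.eventually_lt (f := fun t : ℝ => ‖v + t • x j‖ ^ 2)
        (g := fun t : ℝ => α' ^ 2 * ⟪x i, v + t • x j⟫ ^ 2)
        (by fun_prop) (by fun_prop) ?_)
      have hpos : 0 < ⟪x i, v⟫ ^ 2 := by positivity
      simp only [zero_smul, add_zero, hv, one_pow]
      exact (hA i hi').trans_lt (by gcongr)
    obtain ⟨t, ht, ht0⟩ := (((Filter.eventually_all_finset s).2 hev).and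
      self_mem_nhdsWithin).exists
    have ht0' : 0 < t := ht0
    have hinner : ⟪x j, v + t • x j⟫ = t * ‖x j‖ ^ 2 := by
      rw [inner_add_right, hjs, real_inner_smul_right, real_inner_self_eq_norm_sq, zero_add]
    have hxj : 0 < ‖x j‖ := norm_pos_iff.2 hj
    have hw : v + t • x j ≠ 0 := by
      intro hw
      rw [hw, inner_zero_right] at hinner
      exact (by positivity : t * ‖x j‖ ^ 2 ≠ 0) hinner.symm
    have hw' : 0 < ‖v + t • x j‖ := norm_pos_iff.2 hw
    refine lt_of_lt_of_le ?_ (sum_psi_inner_normalize_le hN α' hw)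
    rw [hcard, hs, ← Finset.sum_boole]
    refine Finset.sum_lt_sum (fun i _ => ?_) ⟨j, Finset.mem_univ _, ?_⟩
    · split_ifs with hi
      · rw [psi_of_nonneg (by positivity), min_eq_right]
        rw [one_le_div (by positivity)]
        exact (ht i (by simpa [hs] using hi)).le
      · exact psi_nonneg (by positivity)
    · rw [if_neg (not_not.2 hjs), psi_of_nonneg (by positivity), hinner]
      positivity

/-- Any positive level below the proportion of nonzero points is attained exactly once. -/
theorem exists_unique_truncatedSup_eq (hN : 1 ≤ N) {T : ℝ} (hT : 0 < T)
    (hlt : N * T < ((Finset.univ.filter fun i => x i ≠ 0).card : ℝ)) :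
    ∃ α : ℝ, (0 < α ∧ truncatedSup x α = T) ∧
      ∀ α' : ℝ, 0 < α' → truncatedSup x α' = T → α' = α := by
  classical
  have hN' : (0 : ℝ) < N := by exact_mod_cast hN
  obtain ⟨v, hv⟩ := exists_forall_inner_ne_zero x
  have hv0 : v ≠ 0 := by
    rintro rfl
    have hpos : (0 : ℝ) < ((Finset.univ.filter fun i => x i ≠ 0).card : ℝ) :=
      (by positivity : 0 < N * T).trans hlt
    obtain ⟨i, hi⟩ := Finset.card_pos.1 (by exact_mod_cast hpos)
    exact hv i (by simpa using hi) (inner_zero_right _)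
  set A : ℝ := ∑ i, ‖v‖ * |⟪x i, v⟫|⁻¹ with hA
  have hA0 : 0 ≤ A := Finset.sum_nonneg fun i _ => by positivity
  have hAT : T ≤ truncatedSup x A := by
    have h := sum_psi_inner_normalize_le (x := x) hN A hv0
    have h2 : ((Finset.univ.filter fun i => x i ≠ 0).card : ℝ) ≤
        ∑ i, psi (A ^ 2 * ⟪x i, v⟫ ^ 2 / ‖v‖ ^ 2) := by
      rw [← Finset.sum_boole]
      refine Finset.sum_le_sum fun i _ => ?_
      split_ifs with hi
      · have hi0 : 0 < |⟪x i, v⟫| := abs_pos.2 (hv i hi)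
        have hle : ‖v‖ * |⟪x i, v⟫|⁻¹ ≤ A :=
          Finset.single_le_sum (f := fun i => ‖v‖ * |⟪x i, v⟫|⁻¹)
            (fun i _ => by positivity) (Finset.mem_univ i)
        rw [psi_of_nonneg (by positivity), min_eq_right]
        rw [one_le_div (by have := norm_pos_iff.2 hv0; positivity), ← sq_abs ⟪x i, v⟫, ← mul_pow]
        gcongr
        rwa [← div_eq_mul_inv, div_le_iff₀ hi0] at hle
      · exact psi_nonneg (by positivity)
    have := hlt.le.trans (h2.trans h)
    exact le_of_mul_le_mul_left this hN'
  obtain ⟨α, hα, hαT⟩ := intermediate_value_Icc hA0 (continuous_truncatedSup x).continuousOn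
    ⟨by rw [truncatedSup_zero hN]; exact hT.le, hAT⟩
  have hα0 : 0 < α := by
    refine lt_of_le_of_ne hα.1 ?_
    rintro rfl
    rw [truncatedSup_zero hN] at hαT
    exact hT.ne hαT
  refine ⟨α, ⟨hα0, hαT⟩, fun α' h0 h' => ?_⟩
  rcases lt_trichotomy α' α with hl | hl | hl
  · have := truncatedSup_lt_of_lt (x := x) hN h0 hl (by rw [h']; exact hlt)
    rw [h', hαT] at this
    exact absurd this (lt_irrefl _)
  · exact hl
  · have := truncatedSup_lt_of_lt (x := x) hN hα0 hl (by rw [hαT]; exact hlt)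
    rw [h', hαT] at this
    exact absurd this (lt_irrefl _)

end Deterministic

/-! ### The covariance operator and the fourth moments of the marginals -/

section Covariance

variable {Ω : Type*} [MeasurableSpace Ω] {P : Measure Ω} {d : ℕ}
  {X : Ω → EuclideanSpace ℝ (Fin d)}

lemma memLp_coord (hX : MemLp X 2 P) (i : Fin d) : MemLp (fun ω => X ω i) 2 P := by
  simpa [EuclideanSpace.inner_single_right] using
    hX.inner_const (𝕜 := ℝ) (EuclideanSpace.single i (1 : ℝ))

lemma integral_coord_eq_zero [IsProbabilityMeasure P] (hX : MemLp X 2 P)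
    (h0 : ∫ ω, X ω ∂P = 0) (i : Fin d) : ∫ ω, X ω i ∂P = 0 := by
  have := integral_inner (𝕜 := ℝ) (hX.integrable (by norm_num)) (EuclideanSpace.single i (1 : ℝ))
  simpa [h0, EuclideanSpace.inner_single_left] using this

lemma inner_toEuclideanCLM_covMatrix [IsProbabilityMeasure P] (hX : MemLp X 2 P)
    (h0 : ∫ ω, X ω ∂P = 0) (u v : EuclideanSpace ℝ (Fin d)) :
    ⟪Matrix.toEuclideanCLM (𝕜 := ℝ) (covMatrix P X) u, v⟫ = ∫ ω, ⟪X ω, u⟫ * ⟪X ω, v⟫ ∂P := by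
  have hm := integral_coord_eq_zero hX h0
  have hij : ∀ i j, Integrable (fun ω => X ω i * X ω j) P := fun i j =>
    (memLp_coord hX i).integrable_mul (memLp_coord hX j)
  have e : ∀ ω, ⟪X ω, u⟫ * ⟪X ω, v⟫ = ∑ i, ∑ j, v i * u j * (X ω i * X ω j) := by
    intro ω
    simp only [PiLp.inner_apply, RCLike.inner_apply, conj_trivial]
    rw [mul_comm, Finset.sum_mul_sum]
    exact Finset.sum_congr rfl fun i _ => Finset.sum_congr rfl fun j _ => by ring
  simp_rw [e]
  rw [integral_finsetSum _ fun i _ => integrable_finsetSum _ fun j _ => (hij i j).const_mul _]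
  simp only [PiLp.inner_apply, RCLike.inner_apply, conj_trivial]
  refine Finset.sum_congr rfl fun i _ => ?_
  rw [integral_finsetSum _ fun j _ => (hij i j).const_mul _]
  simp only [integral_const_mul]
  rw [Matrix.ofLp_toEuclideanCLM, Matrix.mulVec, dotProduct, Finset.mul_sum]
  refine Finset.sum_congr rfl fun j _ => ?_
  simp [covMatrix, covariance, hm]
  ring

lemma integral_inner_sq_eq [IsProbabilityMeasure P] (hX : MemLp X 2 P)
    (h0 : ∫ ω, X ω ∂P = 0) (v : EuclideanSpace ℝ (Fin d)) :
    ∫ ω, ⟪X ω, v⟫ ^ 2 ∂P = ⟪Matrix.toEuclideanCLM (𝕜 := ℝ) (covMatrix P X) v, v⟫ := by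
  rw [inner_toEuclideanCLM_covMatrix hX h0]
  simp_rw [sq]

lemma integral_inner_sq_le_opNorm [IsProbabilityMeasure P] (hX : MemLp X 2 P)
    (h0 : ∫ ω, X ω ∂P = 0) {v : EuclideanSpace ℝ (Fin d)} (hv : ‖v‖ = 1) :
    ∫ ω, ⟪X ω, v⟫ ^ 2 ∂P ≤ opNorm (covMatrix P X) := by
  rw [integral_inner_sq_eq hX h0]
  have h1 := real_inner_le_norm (Matrix.toEuclideanCLM (𝕜 := ℝ) (covMatrix P X) v) v
  have h2 := (Matrix.toEuclideanCLM (𝕜 := ℝ) (covMatrix P X)).le_opNorm v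
  rw [hv, mul_one] at h1 h2
  exact h1.trans h2

lemma exists_integral_inner_sq_eq_opNorm [IsProbabilityMeasure P]
    [Nontrivial (EuclideanSpace ℝ (Fin d))] (hX : MemLp X 2 P) (h0 : ∫ ω, X ω ∂P = 0) :
    ∃ v : EuclideanSpace ℝ (Fin d), ‖v‖ = 1 ∧
      ∫ ω, ⟪X ω, v⟫ ^ 2 ∂P = opNorm (covMatrix P X) := by
  set A := Matrix.toEuclideanCLM (𝕜 := ℝ) (covMatrix P X) with hA
  obtain ⟨v, hv, hmax⟩ := (isCompact_sphere (0 : EuclideanSpace ℝ (Fin d)) 1).exists_isMaxOn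
    (NormedSpace.sphere_nonempty.2 zero_le_one) (f := fun v => ⟪A v, v⟫)
    (Continuous.continuousOn (by fun_prop))
  have hv1 : ‖v‖ = 1 := by simpa using hv
  refine ⟨v, hv1, le_antisymm (integral_inner_sq_le_opNorm hX h0 hv1) ?_⟩
  have hsymm : A.IsSymmetric := by
    intro x y
    change ⟪A x, y⟫ = ⟪x, A y⟫
    rw [real_inner_comm (A y) x, hA, inner_toEuclideanCLM_covMatrix hX h0,
      inner_toEuclideanCLM_covMatrix hX h0]
    simp_rw [mul_comm]
  rw [opNorm, ← hA, A.norm_eq_iSup_rayleighQuotient hsymm]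
  refine ciSup_le fun x => ?_
  have hpos : ∀ y, 0 ≤ ⟪A y, y⟫ := fun y => by
    rw [hA, ← integral_inner_sq_eq hX h0]
    exact integral_nonneg fun ω => sq_nonneg _
  rw [integral_inner_sq_eq hX h0, ← hA, ContinuousLinearMap.rayleighQuotient,
    ContinuousLinearMap.reApplyInnerSelf_apply]
  change |⟪A x, x⟫ / ‖x‖ ^ 2| ≤ _
  rw [abs_of_nonneg (div_nonneg (hpos x) (sq_nonneg _))]
  rcases eq_or_ne x 0 with rfl | hx
  · simpa using hpos v
  · have hx' : ‖x‖ ≠ 0 := norm_ne_zero_iff.2 hx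
    have h : ⟪A (‖x‖⁻¹ • x), ‖x‖⁻¹ • x⟫ ≤ ⟪A v, v⟫ := hmax (by simp [norm_smul, hx'])
    simp only [map_smul, real_inner_smul_left, real_inner_smul_right] at h
    refine le_trans (le_of_eq ?_) h
    field_simp

lemma trace_covMatrix [IsProbabilityMeasure P] (hX : MemLp X 2 P) (h0 : ∫ ω, X ω ∂P = 0) :
    (covMatrix P X).trace = ∫ ω, ‖X ω‖ ^ 2 ∂P := by
  have hm := integral_coord_eq_zero hX h0
  simp_rw [EuclideanSpace.real_norm_sq_eq]
  rw [integral_finsetSum _ fun i _ => (memLp_coord hX i).integrable_sq]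
  simp [Matrix.trace, covMatrix, covariance, hm, sq]

lemma integral_norm_sq_pos [IsProbabilityMeasure P] (hX : MemLp X 2 P)
    (hne : P {ω | X ω = 0} = 0) : 0 < ∫ ω, ‖X ω‖ ^ 2 ∂P := by
  have hae : ∀ᵐ ω ∂P, X ω ≠ 0 := by
    rw [ae_iff]; simpa using hne
  refine lt_of_le_of_ne (integral_nonneg fun ω => by positivity) fun h => ?_
  rw [eq_comm, integral_eq_zero_iff_of_nonneg (fun ω => by positivity)
    (hX.integrable_norm_pow (by norm_num))] at h
  have : ∀ᵐ _ω ∂P, False := by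
    filter_upwards [hae, h] with ω h1 h2
    simp at h2
    exact h1 h2
  rw [ae_iff] at this
  simp at this

lemma opNorm_covMatrix_pos [IsProbabilityMeasure P] (hX : MemLp X 2 P)
    (h0 : ∫ ω, X ω ∂P = 0) (hne : P {ω | X ω = 0} = 0) : 0 < opNorm (covMatrix P X) := by
  by_contra hcon
  have ht := integral_norm_sq_pos hX hne
  simp_rw [EuclideanSpace.real_norm_sq_eq] at ht
  rw [integral_finsetSum _ fun i _ => (memLp_coord hX i).integrable_sq] at ht
  refine absurd ht (not_lt.2 (Finset.sum_nonpos fun i _ => ?_))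
  have := integral_inner_sq_le_opNorm hX h0 (v := EuclideanSpace.single i 1) (by simp)
  simp only [EuclideanSpace.inner_single_right, conj_trivial, one_mul] at this
  linarith

variable {κ : ℝ → ℝ}

/-- The norm equivalence at exponent `4` in terms of integrals. -/
lemma NormEquivalence.integral_inner_pow_four_le (h : NormEquivalence P X 4 κ)
    (hX : MemLp X 2 P) (hκ : 0 ≤ κ 4) (v : EuclideanSpace ℝ (Fin d)) :
    Integrable (fun ω => ⟪X ω, v⟫ ^ 4) P ∧
      ∫ ω, ⟪X ω, v⟫ ^ 4 ∂P ≤ κ 4 ^ 4 * (∫ ω, ⟪X ω, v⟫ ^ 2 ∂P) ^ 2 := by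
  have hf2 : MemLp (fun ω => ⟪X ω, v⟫) 2 P := hX.inner_const v
  have h4 := h v 4 (by norm_num) le_rfl
  rw [show ENNReal.ofReal 4 = 4 by norm_num] at h4
  have hf4 : MemLp (fun ω => ⟪X ω, v⟫) 4 P :=
    ⟨hf2.1, h4.trans_lt (ENNReal.mul_lt_top ENNReal.ofReal_lt_top hf2.2)⟩
  have hi4 : Integrable (fun ω => ⟪X ω, v⟫ ^ 4) P := by
    have := hf4.integrable_norm_pow (p := 4) (by norm_num)
    refine this.congr (ae_of_all _ fun ω => ?_)
    simp only [Real.norm_eq_abs]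
    exact Even.pow_abs (by decide) _
  refine ⟨hi4, ?_⟩
  rw [hf4.eLpNorm_eq_integral_rpow_norm (by norm_num) (by norm_num),
    hf2.eLpNorm_eq_integral_rpow_norm (by norm_num) (by norm_num),
    ← ENNReal.ofReal_mul hκ, ENNReal.ofReal_le_ofReal_iff (by positivity)] at h4
  have e4 : ∀ ω, ‖⟪X ω, v⟫‖ ^ (4 : ENNReal).toReal = ⟪X ω, v⟫ ^ 4 := fun ω => by
    rw [show (4 : ENNReal).toReal = ((4 : ℕ) : ℝ) by norm_num, Real.rpow_natCast,
      Real.norm_eq_abs, Even.pow_abs (by decide)]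
  have e2 : ∀ ω, ‖⟪X ω, v⟫‖ ^ (2 : ENNReal).toReal = ⟪X ω, v⟫ ^ 2 := fun ω => by
    rw [show (2 : ENNReal).toReal = ((2 : ℕ) : ℝ) by norm_num, Real.rpow_natCast,
      Real.norm_eq_abs, sq_abs]
  simp_rw [e4, e2] at h4
  have hn4 : 0 ≤ ∫ ω, ⟪X ω, v⟫ ^ 4 ∂P := integral_nonneg fun ω => by positivity
  have hn2 : 0 ≤ ∫ ω, ⟪X ω, v⟫ ^ 2 ∂P := integral_nonneg fun ω => by positivity
  have h5 := pow_le_pow_left₀ (by positivity) h4 4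
  rw [mul_pow, ← Real.rpow_natCast, ← Real.rpow_mul hn4,
    ← Real.rpow_natCast (_ ^ _) 4, ← Real.rpow_mul hn2] at h5
  norm_num at h5
  exact h5

lemma NormEquivalence.one_le [IsProbabilityMeasure P] [Nontrivial (EuclideanSpace ℝ (Fin d))]
    (h : NormEquivalence P X 4 κ) (hX : MemLp X 2 P) (h0 : ∫ ω, X ω ∂P = 0)
    (hne : P {ω | X ω = 0} = 0) : 1 ≤ κ 4 := by
  obtain ⟨v, -, hv⟩ := exists_integral_inner_sq_eq_opNorm hX h0
  have hpos := opNorm_covMatrix_pos hX h0 hne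
  have hf2 : MemLp (fun ω => ⟪X ω, v⟫) 2 P := hX.inner_const v
  have h2 : eLpNorm (fun ω => ⟪X ω, v⟫) 2 P ≠ 0 := by
    intro hz
    rw [eLpNorm_eq_zero_iff hf2.1 (by norm_num)] at hz
    have : ∫ ω, ⟪X ω, v⟫ ^ 2 ∂P = 0 := by
      rw [← integral_zero Ω ℝ (μ := P)]
      refine integral_congr_ae ?_
      filter_upwards [hz] with ω hω
      simp [hω]
    linarith
  have h4 := h v 4 (by norm_num) le_rfl
  rw [show ENNReal.ofReal 4 = 4 by norm_num] at h4
  have h5 : 1 * eLpNorm (fun ω => ⟪X ω, v⟫) 2 P ≤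
      ENNReal.ofReal (κ 4) * eLpNorm (fun ω => ⟪X ω, v⟫) 2 P := by
    rw [one_mul]
    exact (eLpNorm_le_eLpNorm_of_exponent_le (by norm_num) hf2.1).trans h4
  rw [ENNReal.mul_le_mul_iff_left h2 hf2.2.ne] at h5
  simpa using h5

end Covariance

/-! ### The estimator on an uncorrupted and on a corrupted sample -/

section Sample

variable {d N : ℕ}

/-- At the large scale `α² = 1 / (6 K M)` the truncated supremum of the clean sample exceeds
`3 / (50 K)` with high probability, already because of the direction of largest variance. -/
lemma measure_pi_truncatedSup_le_le {ν : Measure (EuclideanSpace ℝ (Fin d))}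
    [IsProbabilityMeasure ν] (hν : MemLp id 2 ν) {K k M δ α : ℝ} (hK : 0 < K) (hkK : k ≤ K)
    (hM : 0 < M) {v : EuclideanSpace ℝ (Fin d)} (hv : ‖v‖ = 1) (hvM : ∫ x, ⟪x, v⟫ ^ 2 ∂ν = M)
    (hi4 : Integrable (fun x => ⟪x, v⟫ ^ 4) ν) (h4 : ∫ x, ⟪x, v⟫ ^ 4 ∂ν ≤ k * M ^ 2)
    (hδ : 0 < δ) (hδ1 : δ ≤ 1)
    (hN1 : 1 ≤ N) (hN : 400 * K * Real.log (1 / δ) ≤ N)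
    (hα : α ^ 2 = 1 / (6 * K * M)) :
    Measure.pi (fun _ : Fin N => ν) {x | truncatedSup x α ≤ 3 / (50 * K)} ≤
      ENNReal.ofReal δ := by
  have hN' : (0 : ℝ) < N := by exact_mod_cast hN1
  have hsq : ∀ x : EuclideanSpace ℝ (Fin d),
      (α ^ 2 * ⟪x, v⟫ ^ 2) ^ 2 = (α ^ 2) ^ 2 * ⟪x, v⟫ ^ 4 := fun x => by ring
  have hf2 : Integrable (fun x => (α ^ 2 * ⟪x, v⟫ ^ 2) ^ 2) ν := by
    simp_rw [hsq]
    exact hi4.const_mul _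
  have h := measure_pi_sum_psi_le (ν := ν) (f := fun x => α ^ 2 * ⟪x, v⟫ ^ 2) (by fun_prop)
    (fun x => by positivity) ((integrable_inner_sq hν v).const_mul _) hf2 N (N * (3 / (50 * K)))
  refine le_trans (measure_mono ?_) (h.trans (ENNReal.ofReal_le_ofReal ?_))
  · intro x hx
    have hx' : truncatedSup x α ≤ 3 / (50 * K) := hx
    refine (sum_psi_le_truncatedSup hN1 α hv).trans ?_
    gcongr
  · rw [← Real.le_log_iff_exp_le hδ]
    simp_rw [hsq]
    rw [integral_const_mul, integral_const_mul, hvM, hα]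
    have e1 : 1 / (6 * K * M) * M = 1 / K * (1 / 6) := by field_simp
    have e2 : (1 / (6 * K * M)) ^ 2 * ∫ x, ⟪x, v⟫ ^ 4 ∂ν ≤ 1 / K * (1 / 36) := by
      calc _ ≤ (1 / (6 * K * M)) ^ 2 * (K * M ^ 2) := by
            gcongr
            exact h4.trans (by gcongr)
        _ = _ := by field_simp; norm_num
    have e3 : 400 * Real.log (1 / δ) ≤ N / K := by
      rw [le_div_iff₀ hK]; linarith
    have e4 : Real.log (1 / δ) = -Real.log δ := by rw [one_div, Real.log_inv]
    have e5 : 0 ≤ N / K := by positivity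
    have e6 : Real.log δ ≤ 0 := Real.log_nonpos hδ.le hδ1
    have e7 : (N : ℝ) * (1 / K * (1 / 6) - 1 / K * (1 / 36)) ≤
        N * (1 / K * (1 / 6) - (1 / (6 * K * M)) ^ 2 * ∫ x, ⟪x, v⟫ ^ 4 ∂ν) := by
      gcongr
    have e8 : (N : ℝ) * (1 / K * (1 / 6) - 1 / K * (1 / 36)) = N / K * (5 / 36) := by ring
    have e9 : (N : ℝ) * (3 / (50 * K)) = N / K * (3 / 50) := by field_simp
    rw [e1, e9]
    -- `5 / 36 - 3 / 50 > 1 / 400`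
    linarith

variable [Nontrivial (EuclideanSpace ℝ (Fin d))]

/-- At the small scale `α² = 1 / (96 K M)` the truncated supremum of the clean sample stays below
`1 / (20 K)` with high probability. The smoothing parameter is the effective rank `t / M`. -/
lemma measure_pi_le_truncatedSup_le {ν : Measure (EuclideanSpace ℝ (Fin d))}
    [IsProbabilityMeasure ν] (hν : MemLp id 2 ν) {K M t δ α : ℝ} (hK : 0 < K) (hM : 0 < M)
    (ht : ∫ x, ‖x‖ ^ 2 ∂ν = t) (ht0 : 0 < t)
    (hS : ∀ v : EuclideanSpace ℝ (Fin d), ‖v‖ = 1 → ∫ x, ⟪x, v⟫ ^ 2 ∂ν ≤ M) (hδ : 0 < δ)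
    (hδ1 : δ ≤ 1) (hN1 : 1 ≤ N) (hN : 100 * K * (t / M) + 400 * K * Real.log (1 / δ) ≤ N)
    (hα : α ^ 2 = 1 / (96 * K * M)) :
    Measure.pi (fun _ : Fin N => ν) {x | 1 / (20 * K) ≤ truncatedSup x α} ≤
      ENNReal.ofReal δ := by
  refine le_trans (measure_mono ?_) (measure_pi_exists_lt_sum_psi_le hν hS α
    (β := t / M) (by positivity) hδ N)
  intro x hx
  obtain ⟨v, hv, hsum⟩ := exists_sum_psi_eq_truncatedSup hN1 x α
  refine ⟨v, hv, ?_⟩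
  have hN' : (0 : ℝ) < N := by exact_mod_cast hN1
  have hx' : 1 / (20 * K) ≤ truncatedSup x α := hx
  rw [hsum, ht, hα]
  have e1 : (N : ℝ) * (1 / (96 * K * M) * (M + t / (t / M))) = N / K * (1 / 48) := by
    field_simp; norm_num
  have e2 : t / M / 2 + Real.log (1 / δ) ≤ N / K * (1 / 200) := by
    have h1 : 100 * (t / M) + 400 * Real.log (1 / δ) ≤ N / K := by
      rw [le_div_iff₀ hK]; linarith
    have h2 : 0 ≤ Real.log (1 / δ) := Real.log_nonneg (by rwa [le_div_iff₀ hδ, one_mul])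
    linarith
  have e3 : Real.log 2 * (N / K * (1 / 20)) ≤ Real.log 2 * (N * truncatedSup x α) := by
    have : N / K * (1 / 20) = N * (1 / (20 * K)) := by field_simp
    rw [this]
    have := Real.log_pos (x := 2) (by norm_num)
    gcongr
  have h3 : 0 < N / K := by positivity
  have h4 : (0.69 : ℝ) * (N / K * (1 / 20)) ≤ Real.log 2 * (N / K * (1 / 20)) := by
    gcongr
    linarith [Real.log_two_gt_d9]
  rw [e1]
  -- `1 / 48 + 1 / 200 < 0.69 / 20`
  linarith

/-- When fewer than `(1 - T) N` points of a nowhere vanishing sample are corrupted, the level `T`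
is still attained exactly once. -/
lemma exists_unique_truncatedSup_eq_of_corrupted (hN1 : 1 ≤ N)
    {x y : Fin N → EuclideanSpace ℝ (Fin d)} {η T : ℝ} (hx : ∀ i, x i ≠ 0)
    (h : (({i | y i ≠ x i}.ncard : ℕ) : ℝ) ≤ η * N) (hT : 0 < T) (hTη : T + η < 1) :
    ∃ α : ℝ, (0 < α ∧ truncatedSup y α = T) ∧
      ∀ α' : ℝ, 0 < α' → truncatedSup y α' = T → α' = α := by
  classical
  have hN' : (0 : ℝ) < N := by exact_mod_cast hN1
  refine exists_unique_truncatedSup_eq hN1 hT ?_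
  rw [Set.ncard_eq_toFinset_card'] at h
  simp only [Set.toFinset_ofPred] at h
  have h1 : N ≤ (Finset.univ.filter fun i => y i ≠ 0).card +
      (Finset.univ.filter fun i => y i ≠ x i).card := by
    refine le_trans ?_ (Finset.card_union_le _ _)
    rw [← Finset.filter_or, Finset.filter_true_of_mem, Finset.card_univ, Fintype.card_fin]
    intro i _
    by_cases hi : y i = 0
    · exact Or.inr (by rw [hi]; exact (hx i).symm)
    · exact Or.inl hi
  have h2 : (N : ℝ) ≤ ((Finset.univ.filter fun i => y i ≠ 0).card : ℝ) +
      ((Finset.univ.filter fun i => y i ≠ x i).card : ℝ) := by exact_mod_cast h1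
  have h3 : N * (T + η) < N * 1 := by gcongr
  linarith

/-- Comparison of the solution on the corrupted sample with the two reference scales, from the
behaviour of the clean sample at these scales. -/
lemma estimate_of_truncatedSup_bounds (hN1 : 1 ≤ N) {x y : Fin N → EuclideanSpace ℝ (Fin d)}
    {η K M α₀ α₁ α : ℝ} (h : (({i | y i ≠ x i}.ncard : ℕ) : ℝ) ≤ η * N) (hK : 0 < K)
    (hη : η ≤ 1 / (300 * K)) (hM : 0 < M) (hα₀ : 0 < α₀) (hα₁ : 0 < α₁) (hα : 0 < α)
    (hα₀' : α₀ ^ 2 = 1 / (96 * K * M)) (hα₁' : α₁ ^ 2 = 1 / (6 * K * M))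
    (h₀ : truncatedSup x α₀ < 1 / (20 * K)) (h₁ : 3 / (50 * K) < truncatedSup x α₁)
    (hy : truncatedSup y α = 1 / (20 * K) + η) :
    1 / 4 * M ≤ 1 / (24 * K * α ^ 2) ∧ 1 / (24 * K * α ^ 2) ≤ 4 * M := by
  have h' : (({i | x i ≠ y i}.ncard : ℕ) : ℝ) ≤ η * N := by
    simpa only [ne_comm] using h
  have hK1 : (0 : ℝ) < 1 / K := by positivity
  have c1 : 1 / (20 * K) = 1 / K * (1 / 20) := by field_simp
  have c2 : 3 / (50 * K) = 1 / K * (3 / 50) := by field_simp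
  have c3 : 1 / (300 * K) = 1 / K * (1 / 300) := by field_simp
  rw [c1] at h₀ hy
  rw [c2] at h₁
  rw [c3] at hη
  have hlo : α₀ < α := by
    by_contra hcon
    have := truncatedSup_mono (x := y) hN1 hα.le (not_lt.1 hcon)
    have := truncatedSup_le_add hN1 h α₀
    linarith
  have hhi : α < α₁ := by
    by_contra hcon
    have := truncatedSup_mono (x := y) hN1 hα₁.le (not_lt.1 hcon)
    have := truncatedSup_le_add hN1 h' α₁
    linarith
  have hlo2 : 1 / (96 * K * M) < α ^ 2 := by rw [← hα₀']; gcongr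
  have hhi2 : α ^ 2 < 1 / (6 * K * M) := by rw [← hα₁']; gcongr
  rw [div_lt_iff₀ (by positivity)] at hlo2
  rw [lt_div_iff₀ (by positivity)] at hhi2
  constructor
  · rw [le_div_iff₀ (by positivity)]
    linarith
  · rw [div_le_iff₀ (by positivity)]
    linarith

end Sample

end RobustCov

open RobustCov

theorem mainTheorem4 :
    ∃ c₀ : ℝ, 1 ≤ c₀ ∧ ∀ c : ℝ, c₀ ≤ c →
      -- the dimension, the random vector `X` and its `L_4`-`L_2` norm equivalence
      ∀ (d : ℕ) {Ω₀ : Type*} [MeasurableSpace Ω₀] (P : Measure Ω₀) [IsProbabilityMeasure P]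
        (X : Ω₀ → EuclideanSpace ℝ (Fin d)) (κ : ℝ → ℝ),
        MemLp X 2 P → (∫ ω, X ω ∂P) = 0 →
        RobustCov.NormEquivalence P X 4 κ →
        P {ω | X ω = 0} = 0 →
      ∀ η δ : ℝ, 0 ≤ η → η ≤ 1 / (300 * c * κ 4 ^ 4) → 0 < δ → δ < 1 / 4 →
      -- the i.i.d. sample `Xs` and the corrupted sample `Xt`
      ∀ (N : ℕ) {Ω : Type*} [MeasurableSpace Ω] (μ : Measure Ω) [IsProbabilityMeasure μ]
        (Xs Xt : Fin N → Ω → EuclideanSpace ℝ (Fin d)),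
        1 ≤ N → iIndepFun Xs μ → (∀ i, IdentDistrib (Xs i) X μ P) →
        RobustCov.IsCorruptedSample μ η Xs Xt →
      ∃ αhat : Ω → ℝ,
        (∀ᵐ ω ∂μ,
          (0 < αhat ω ∧ RobustCov.truncatedSup (fun i => Xt i ω) (αhat ω)
            = 1 / (20 * c * κ 4 ^ 4) + η) ∧
          ∀ α : ℝ, 0 < α → RobustCov.truncatedSup (fun i => Xt i ω) α
            = 1 / (20 * c * κ 4 ^ 4) + η → α = αhat ω) ∧
        (100 * c * κ 4 ^ 4 * RobustCov.effectiveRank (RobustCov.covMatrix P X)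
            + 400 * c * κ 4 ^ 4 * Real.log (1 / δ) ≤ (N : ℝ) →
          ∃ G : Set Ω, MeasurableSet G ∧ ENNReal.ofReal (1 - 4 * δ) ≤ μ G ∧
            ∀ ω ∈ G,
              1 / 4 * RobustCov.opNorm (RobustCov.covMatrix P X)
                ≤ 1 / (24 * c * κ 4 ^ 4 * αhat ω ^ 2) ∧
              1 / (24 * c * κ 4 ^ 4 * αhat ω ^ 2)
                ≤ 4 * RobustCov.opNorm (RobustCov.covMatrix P X)) := by
  refine ⟨1, le_rfl, ?_⟩
  intro c hc d Ω₀ _ P _ X κ hX h0 hκ hne η δ hη0 hη hδ hδ4 N Ω _ μ _ Xs Xt hN1 hind hid hcor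
  -- In dimension zero every vector vanishes, against `P (X = 0) = 0`.
  have hnt : Nontrivial (EuclideanSpace ℝ (Fin d)) := by
    rcases Nat.eq_zero_or_pos d with rfl | hd
    · have : {ω | X ω = 0} = Set.univ := Set.eq_univ_of_forall fun ω => Subsingleton.elim _ _
      rw [this, measure_univ] at hne
      exact absurd hne one_ne_zero
    · have : Nonempty (Fin d) := ⟨⟨0, hd⟩⟩
      infer_instance
  have hκ1 : 1 ≤ κ 4 := hκ.one_le hX h0 hne
  set M := opNorm (covMatrix P X) with hMdef
  have hM : 0 < M := opNorm_covMatrix_pos hX h0 hne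
  set K : ℝ := c * κ 4 ^ 4 with hKdef
  have hκ4 : 1 ≤ κ 4 ^ 4 := one_le_pow₀ hκ1
  have hkK : κ 4 ^ 4 ≤ K := le_mul_of_one_le_left (by positivity) hc
  have hK1 : 1 ≤ K := hκ4.trans hkK
  have hK : 0 < K := by linarith
  simp only [mul_assoc, ← hKdef] at hη ⊢
  simp only [← mul_assoc] at hη ⊢
  have hK20 : 1 / (20 * K) ≤ 1 / 20 :=
    one_div_le_one_div_of_le (by norm_num) (by linarith)
  have hK300 : 1 / (300 * K) ≤ 1 / 300 :=
    one_div_le_one_div_of_le (by norm_num) (by linarith)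
  have hT : 0 < 1 / (20 * K) + η := by positivity
  -- Almost surely no point of the clean sample vanishes.
  have hXne : ∀ᵐ ω ∂μ, ∀ i, Xs i ω ≠ 0 := by
    rw [ae_all_iff]
    intro i
    rw [ae_iff]
    have := (hid i).measure_mem_eq (measurableSet_singleton 0)
    simp only [Set.preimage, Set.mem_singleton_iff] at this
    simpa using this.trans hne
  have hgood : ∀ᵐ ω ∂μ, ∃ α : ℝ,
      (0 < α ∧ truncatedSup (fun i => Xt i ω) α = 1 / (20 * K) + η) ∧
      ∀ α' : ℝ, 0 < α' → truncatedSup (fun i => Xt i ω) α' = 1 / (20 * K) + η → α' = α := by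
    filter_upwards [hXne, hcor] with ω h1 h2
    exact exists_unique_truncatedSup_eq_of_corrupted hN1 h1 h2 hT (by linarith)
  have hchoice : ∀ ω, ∃ α : ℝ, (∃ α : ℝ,
      (0 < α ∧ truncatedSup (fun i => Xt i ω) α = 1 / (20 * K) + η) ∧
      ∀ α' : ℝ, 0 < α' → truncatedSup (fun i => Xt i ω) α' = 1 / (20 * K) + η → α' = α) →
      (0 < α ∧ truncatedSup (fun i => Xt i ω) α = 1 / (20 * K) + η) ∧
      ∀ α' : ℝ, 0 < α' → truncatedSup (fun i => Xt i ω) α' = 1 / (20 * K) + η → α' = α := by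
    intro ω
    by_cases h : ∃ α : ℝ,
      (0 < α ∧ truncatedSup (fun i => Xt i ω) α = 1 / (20 * K) + η) ∧
      ∀ α' : ℝ, 0 < α' → truncatedSup (fun i => Xt i ω) α' = 1 / (20 * K) + η → α' = α
    · exact ⟨h.choose, fun _ => h.choose_spec⟩
    · exact ⟨0, fun h' => absurd h' h⟩
  choose αhat hαhat using hchoice
  have hsol := hgood.mono fun ω h => hαhat ω h
  refine ⟨αhat, hsol, fun hN => ?_⟩
  rw [effectiveRank, ← hMdef] at hN
  -- The two tail bounds concern the law `ν` of `X` on `ℝ^d`.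
  set ν := P.map X with hνdef
  have hXm : AEMeasurable X P := hX.1.aemeasurable
  have hνp : IsProbabilityMeasure ν := Measure.isProbabilityMeasure_map hXm
  have hν : MemLp id 2 ν := (memLp_map_measure_iff (by fun_prop) hXm).2 hX
  have hint : ∀ f : EuclideanSpace ℝ (Fin d) → ℝ, Continuous f →
      ∫ x, f x ∂ν = ∫ ω, f (X ω) ∂P := fun f hf =>
    integral_map hXm hf.aestronglyMeasurable
  have ht : ∫ x, ‖x‖ ^ 2 ∂ν = (covMatrix P X).trace := by
    rw [trace_covMatrix hX h0, hint _ (by fun_prop)]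
  have ht0 : 0 < (covMatrix P X).trace := by
    rw [trace_covMatrix hX h0]
    exact integral_norm_sq_pos hX hne
  have hS : ∀ v : EuclideanSpace ℝ (Fin d), ‖v‖ = 1 → ∫ x, ⟪x, v⟫ ^ 2 ∂ν ≤ M := fun v hv => by
    rw [hint _ (by fun_prop)]
    exact integral_inner_sq_le_opNorm hX h0 hv
  obtain ⟨v, hv, hvM⟩ := exists_integral_inner_sq_eq_opNorm hX h0
  obtain ⟨hi4, h4⟩ := hκ.integral_inner_pow_four_le hX (by linarith) v
  rw [hvM] at h4
  set α₀ : ℝ := √(1 / (96 * K * M)) with hα₀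
  set α₁ : ℝ := √(1 / (6 * K * M)) with hα₁
  have hα₀' : α₀ ^ 2 = 1 / (96 * K * M) := Real.sq_sqrt (by positivity)
  have hα₁' : α₁ ^ 2 = 1 / (6 * K * M) := Real.sq_sqrt (by positivity)
  have hB₀ := measure_pi_le_truncatedSup_le (N := N) hν hK hM ht ht0 hS hδ (by linarith) hN1 hN hα₀'
  have hB₁ := measure_pi_truncatedSup_le_le (N := N) hν hK hkK hM hv
    ((hint _ (by fun_prop)).trans hvM)
    ((integrable_map_measure (Continuous.aestronglyMeasurable (by fun_prop)) hXm).2 hi4)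
    ((hint _ (by fun_prop)).trans_le h4) hδ (by linarith) hN1
    (by have : 0 ≤ 100 * K * ((covMatrix P X).trace / M) := by positivity
        linarith) hα₁'
  set B : Set (Fin N → EuclideanSpace ℝ (Fin d)) :=
    {x | 1 / (20 * K) ≤ truncatedSup x α₀} ∪ {x | truncatedSup x α₁ ≤ 3 / (50 * K)} with hB
  have hXsm : ∀ i, AEMeasurable (Xs i) μ := fun i => (hid i).aemeasurable_fst
  have hlaw : μ.map (fun ω i => Xs i ω) = Measure.pi fun _ => ν := by
    rw [(iIndepFun_iff_map_fun_eq_pi_map hXsm).1 hind]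
    simp_rw [fun i => (hid i).map_eq, hνdef]
  have hBμ : μ ((fun ω i => Xs i ω) ⁻¹' B) ≤ ENNReal.ofReal (4 * δ) := by
    calc _ ≤ (Measure.pi fun _ => ν) B := by
          rw [← hlaw]
          exact Measure.le_map_apply (aemeasurable_pi_lambda _ hXsm) _
      _ ≤ ENNReal.ofReal δ + ENNReal.ofReal δ := (measure_union_le _ _).trans (by gcongr)
      _ ≤ _ := by
          rw [← ENNReal.ofReal_add hδ.le hδ.le]
          exact ENNReal.ofReal_le_ofReal (by linarith)
  set S : Set Ω := {ω | 1 / 4 * M ≤ 1 / (24 * K * αhat ω ^ 2) ∧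
    1 / (24 * K * αhat ω ^ 2) ≤ 4 * M} with hSdef
  have hSμ : μ Sᶜ ≤ ENNReal.ofReal (4 * δ) := by
    refine le_trans (measure_mono_ae ?_) hBμ
    filter_upwards [hsol, hcor] with ω h1 h2 hω
    by_contra hωB
    have hωB' : (fun i => Xs i ω) ∉ B := hωB
    simp only [hB, Set.mem_union, Set.mem_ofPred_eq, not_or, not_le] at hωB'
    exact hω (estimate_of_truncatedSup_bounds hN1 h2 hK hη hM (by positivity) (by positivity)
      h1.1.1 hα₀' hα₁' hωB'.1 hωB'.2 h1.1.2)
  -- `S` need not be measurable, so its complement is enlarged to a measurable set.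
  refine ⟨(toMeasurable μ Sᶜ)ᶜ, (measurableSet_toMeasurable _ _).compl, ?_, fun ω hω => ?_⟩
  · rw [prob_compl_eq_one_sub (measurableSet_toMeasurable _ _), measure_toMeasurable,
      ENNReal.ofReal_sub _ (by positivity), ENNReal.ofReal_one]
    exact tsub_le_tsub_left hSμ 1
  · have := Set.compl_subset_comm.1 (subset_toMeasurable μ Sᶜ) hω
    exact this
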